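/- Definitions. For a finite simple graph $X$ with adjacency matrix $A$ put $U(t)=e^{itA}$. Perfect state transfer occurs in $X$ at time $t\in\mathbb R$ if there are distinct vertices $u,v$ and $\gamma\in\mathbb C$ with $U(t)e_u=\gamma e_v$. A distance-regular $(n,2,c)$ cover (of the complete graph $K_n$) is a connected distance-regular graph of diameter $3$ with intersection array $\{n-1,\,c,\,1;\;1,\,c,\,n-1\}$ whose vertex set is partitioned into $n$ independent cells of size $2$ such that the edges between any two distinct cells form a perfect matching. Theorem. Let $X$ be a distance-regular $(n,2,c)$ cover, and let $X_2$ be its distance-two graph, i.e. the graph on the vertices of $X$ in which two vertices are adjacent if and only if they are at distance $2$ in $X$. Put $\delta=n-2c-2$ and suppose that $\delta\notin\{0,2,-2\}$. Then: (1) If $c\neq n-2$, then $X_2$ is a distance-regular $(n,2,n-2-c)$ cover. (2) If $\delta\equiv 2 \pmod 4$, then there is a positive odd integer $a$ such that perfect state transfer occurs at time $\frac{\pi}{2a}$ in at least one of $X$ and $X_2$. (3) If $\delta$ is odd or divisible by $4$, then perfect state transfer occurs at no time in $X$ and at no time in $X_2$. -/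

import Mathlib

/-- The transition matrix `U(t) = exp(i t A)` of the continuous-time quantum walk on `X`, where `A`
is the adjacency matrix of `X`. -/
noncomputable def transitionMatrix {V : Type*} [Fintype V] [DecidableEq V] (X : SimpleGraph V)
    (t : ℝ) : Matrix V V ℂ :=
  open Classical in NormedSpace.exp ((Complex.I * (t : ℂ)) • X.adjMatrix ℂ)

/-- Perfect state transfer occurs in `X` at time `t`: there are distinct vertices `u`, `v` with
`U(t) e_u = γ e_v` for some complex number `γ`. -/
def PerfectStateTransferAt {V : Type*} [Fintype V] [DecidableEq V] (X : SimpleGraph V)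
    (t : ℝ) : Prop :=
  ∃ u v : V, u ≠ v ∧ ∃ γ : ℂ,
    Matrix.mulVec (transitionMatrix X t) (Pi.single u (1 : ℂ)) = γ • (Pi.single v (1 : ℂ) : V → ℂ)

/-- `X` admits perfect state transfer (at some time). -/
def AdmitsPerfectStateTransfer {V : Type*} [Fintype V] [DecidableEq V]
    (X : SimpleGraph V) : Prop :=
  ∃ t : ℝ, PerfectStateTransferAt X t

/-- The number of neighbours of `v` at distance `j` from `u`. -/
noncomputable def neighborsAtDist {V : Type*} (X : SimpleGraph V) (u v : V) (j : ℕ) : ℕ :=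
  {w : V | X.Adj v w ∧ X.dist u w = j}.ncard

/-- `X` is a (connected) distance-regular graph of diameter `d` with intersection array
`{b_0, …, b_{d-1}; c_1, …, c_d}`. The entry `c_{i+1}` is written `c i` for `i : Fin d`.
At the ends, `c_0 = 0` and `b_d = 0` hold automatically. -/
structure HasIntersectionArray {V : Type*} (X : SimpleGraph V) {d : ℕ}
    (b c : Fin d → ℕ) : Prop where
  connected : X.Connected
  diam_eq : X.diam = d
  card_farther : ∀ (i : Fin d) (u v : V), X.dist u v = i →
    neighborsAtDist X u v (i + 1) = b i
  card_closer : ∀ (i : Fin d) (u v : V), X.dist u v = i + 1 →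
    neighborsAtDist X u v i = c i

/-- `X` is an `r`-fold covering of `Y`, with the fibres of `p` as cells: every cell has `r`
vertices and is an independent set, the edges between the cells of two adjacent vertices of `Y`
form a perfect matching, and there are no edges between other cells. -/
structure IsFoldCovering {V W : Type*} (X : SimpleGraph V) (Y : SimpleGraph W) (r : ℕ)
    (p : V → W) : Prop where
  ncard_cell : ∀ y : W, {v : V | p v = y}.ncard = r
  independent : ∀ u v : V, p u = p v → ¬ X.Adj u v
  no_edges : ∀ u v : V, p u ≠ p v → ¬ Y.Adj (p u) (p v) → ¬ X.Adj u v
  matching : ∀ (u : V) (y : W), Y.Adj (p u) y → ∃! v : V, p v = y ∧ X.Adj u v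

/-- `X` is a distance-regular `(n, r, c)` covering of the complete graph `K_n`: an `r`-fold
covering of `K_n` that is distance-regular with intersection array
`{n - 1, (r - 1) c, 1; 1, c, n - 1}`. (The diameter is 3, so `n` and `r` are positive
and the subtractions do not truncate.) -/
def IsDistanceRegularCover {V : Type*} (X : SimpleGraph V) (n r c : ℕ) : Prop :=
  (∃ p : V → Fin n, IsFoldCovering X (⊤ : SimpleGraph (Fin n)) r p) ∧
    HasIntersectionArray X ![n - 1, (r - 1) * c, 1] ![1, c, n - 1]

/-- The distance-two graph `X_2` of `X`. -/
def distanceTwoGraph {V : Type*} (X : SimpleGraph V) : SimpleGraph V where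
  Adj u v := X.dist u v = 2
  symm := ⟨fun u v h => by rw [SimpleGraph.dist_comm]; exact h⟩
  loopless := ⟨fun u h => by simp at h⟩

/-! Let `A` be the adjacency matrix of `X` and `P` the permutation matrix of the fibre swap `σ`;
they commute. Vertices of different fibres are nonadjacent exactly when swapping one makes them
adjacent, so `X_2` has adjacency matrix `P * A` and is again a `TwoCover`, with parameter `n - 2 -
c` (`TwoCover.of_adj_swap`). `TwoCover` does not require connectivity, so the boundary case `c = n -
2`, where `X_2` has parameter 0, is treated together with the others.

On vectors fixed by `P` the eigenvalues of `A` are `n - 1` and `-1`; on vectors negated by `P` they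
are the roots `θ`, `τ` of `x² - δ x - (n - 1)`, and those of `P * A` are `-θ`, `-τ`. A trace
argument with `δ ≠ 0` makes `θ` and `τ` integers. Hence `U(t)` is a Laurent polynomial in `z =
e^{it}`. Perfect state transfer forces `z^(θ+1) = z^(τ+1) = -1`, and these two equations with `z^n =
1` suffice for it.

The rest is parity, using `(θ+1) + (τ+1) = δ + 2` and `(θ+1)(τ+1) = -2c`. If `δ` is odd or divisible
by 4, the two equations conflict, for `X` and `X_2` alike. If `δ ≡ 2` mod 4, then `z = i` solves
them for `X` or for `X_2`, so `a = 1` always works. -/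

/-- Combinatorial description of a distance-regular antipodal double cover of a complete graph:
the fibres of `p` are the pairs `{u, σ u}`, every vertex is adjacent to exactly one vertex of each
other fibre, and nonadjacent vertices of different fibres have `c` common neighbours. -/
structure TwoCover {V : Type*} (Y : SimpleGraph V) {n : ℕ} (p : V → Fin n) (σ : V → V) (c : ℕ) :
    Prop where
  p_swap : ∀ u, p (σ u) = p u
  swap_ne : ∀ u, σ u ≠ u
  eq_or_eq : ∀ u v, p v = p u → v = u ∨ v = σ u
  not_adj : ∀ u v, p u = p v → ¬ Y.Adj u v
  adj_swap_iff : ∀ u v, p u ≠ p v → (Y.Adj (σ u) v ↔ ¬ Y.Adj u v)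
  common : ∀ u v, p u ≠ p v → ¬ Y.Adj u v → {w | Y.Adj u w ∧ Y.Adj v w}.ncard = c
  surj : Function.Surjective p

theorem SimpleGraph.Connected.exists_adj_adj_of_dist_eq_two {V : Type*} {G : SimpleGraph V}
    (hG : G.Connected) {u v : V} (h : G.dist u v = 2) : ∃ w, G.Adj u w ∧ G.Adj w v := by
  obtain ⟨q, hq⟩ := hG.exists_walk_length_eq_dist u v
  rw [h] at hq
  match q, hq with
  | .cons a (.cons b .nil), _ => exact ⟨_, a, b⟩

theorem SimpleGraph.Connected.exists_adj_adj_adj_of_dist_eq_three {V : Type*} {G : SimpleGraph V}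
    (hG : G.Connected) {u v : V} (h : G.dist u v = 3) :
    ∃ w x, G.Adj u w ∧ G.Adj w x ∧ G.Adj x v := by
  obtain ⟨q, hq⟩ := hG.exists_walk_length_eq_dist u v
  rw [h] at hq
  match q, hq with
  | .cons a (.cons b (.cons d .nil)), _ => exact ⟨_, _, a, b, d⟩

/-! ### Combinatorics of double covers and their distances. -/

namespace TwoCover

variable {V : Type*} {Y : SimpleGraph V} {n : ℕ} {p : V → Fin n} {σ : V → V} {c : ℕ}

theorem p_ne (h : TwoCover Y p σ c) {u v : V} (huv : Y.Adj u v) : p u ≠ p v :=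
  fun e => h.not_adj u v e huv

theorem swap_swap (h : TwoCover Y p σ c) (u : V) : σ (σ u) = u := by
  rcases h.eq_or_eq u (σ (σ u)) (by rw [h.p_swap, h.p_swap]) with e | e
  · exact e
  · exact absurd e (h.swap_ne _)

theorem adj_swap_left_iff (h : TwoCover Y p σ c) (u v : V) :
    Y.Adj (σ u) v ↔ Y.Adj u (σ v) := by
  by_cases e : p u = p v
  · have h1 := h.not_adj (σ u) v (by rw [h.p_swap, e])
    have h2 := h.not_adj u (σ v) (by rw [h.p_swap, e])
    tauto
  · have h1 := h.adj_swap_iff u v e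
    have h2 := h.adj_swap_iff v u (Ne.symm e)
    rw [Y.adj_comm, Y.adj_comm v u] at h2
    tauto

theorem adj_swap_swap_iff (h : TwoCover Y p σ c) (u v : V) :
    Y.Adj (σ u) (σ v) ↔ Y.Adj u v := by
  rw [h.adj_swap_left_iff, h.swap_swap]

theorem exists_adj (h : TwoCover Y p σ c) (u : V) (y : Fin n) (hy : p u ≠ y) :
    ∃ v, p v = y ∧ Y.Adj u v := by
  obtain ⟨w, rfl⟩ := h.surj y
  by_cases a : Y.Adj u w
  · exact ⟨w, rfl, a⟩
  · exact ⟨σ w, h.p_swap w, (h.adj_swap_left_iff u w).1 ((h.adj_swap_iff u w hy).2 a)⟩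

theorem eq_of_adj (h : TwoCover Y p σ c) {u v w : V} (hv : Y.Adj u v) (hw : Y.Adj u w)
    (e : p w = p v) : w = v := by
  rcases h.eq_or_eq v w e with r | r
  · exact r
  · subst r
    rw [← h.adj_swap_left_iff, h.adj_swap_iff u v (h.p_ne hv)] at hw
    exact absurd hv hw

theorem isFoldCovering (h : TwoCover Y p σ c) :
    IsFoldCovering Y (⊤ : SimpleGraph (Fin n)) 2 p where
  ncard_cell y := by
    obtain ⟨u, rfl⟩ := h.surj y
    have : {v : V | p v = p u} = {u, σ u} := by
      ext v
      constructor
      · exact fun e => h.eq_or_eq u v e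
      · rintro (rfl | rfl)
        · rfl
        · exact h.p_swap u
    rw [this, Set.ncard_pair (h.swap_ne u).symm]
  independent := h.not_adj
  no_edges u v e ne := absurd ((SimpleGraph.top_adj _ _).2 e) ne
  matching u y hy := by
    obtain ⟨v, rfl, hv⟩ := h.exists_adj u y ((SimpleGraph.top_adj _ _).1 hy)
    exact ⟨v, ⟨rfl, hv⟩, fun w hw => h.eq_of_adj hv hw.2 hw.1⟩

theorem ncard_neighbors (h : TwoCover Y p σ c) (u : V) : {w | Y.Adj u w}.ncard = n - 1 := by
  have inj : Set.InjOn p {w | Y.Adj u w} := fun v hv w hw e => h.eq_of_adj hw hv e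
  rw [← inj.ncard_image]
  have : p '' {w | Y.Adj u w} = {p u}ᶜ := by
    ext y
    constructor
    · rintro ⟨w, hw, rfl⟩
      exact (h.p_ne hw).symm
    · intro hy
      obtain ⟨v, hv, a⟩ := h.exists_adj u y (Ne.symm hy)
      exact ⟨v, a, hv⟩
  rw [this, Set.ncard_compl, Set.ncard_singleton, Nat.card_eq_fintype_card, Fintype.card_fin]

/-- The `n - 2` neighbours of `u` other than `v` are each adjacent to exactly one of `v` and `σ v`;
since `u` and `σ v` are nonadjacent, `c` of them go to `σ v`. -/
theorem common_of_adj [Finite V] (h : TwoCover Y p σ c) {u v : V} (huv : Y.Adj u v) :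
    {w | Y.Adj u w ∧ Y.Adj v w}.ncard + c + 2 = n := by
  have hp : p u ≠ p (σ v) := by rw [h.p_swap]; exact h.p_ne huv
  have hnot : ¬ Y.Adj u (σ v) := by
    rw [← h.adj_swap_left_iff, h.adj_swap_iff u v (h.p_ne huv)]
    exact not_not.2 huv
  have hc := h.common u (σ v) hp hnot
  have split : {w | Y.Adj u w} =
      insert v ({w | Y.Adj u w ∧ Y.Adj v w} ∪ {w | Y.Adj u w ∧ Y.Adj (σ v) w}) := by
    ext w
    simp only [Set.mem_insert_iff, Set.mem_union, Set.mem_ofPred_eq]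
    constructor
    · intro hw
      by_cases e : p w = p v
      · exact Or.inl (h.eq_of_adj huv hw e)
      · have := h.adj_swap_iff v w (Ne.symm e)
        tauto
    · rintro (rfl | hw | hw)
      · exact huv
      · exact hw.1
      · exact hw.1
  have hn := h.ncard_neighbors u
  rw [split, Set.ncard_insert_of_notMem, Set.ncard_union_eq, hc] at hn
  · have := (p u).pos
    omega
  · rw [Set.disjoint_left]
    rintro w ⟨_, h1⟩ ⟨_, h2⟩
    exact (h.adj_swap_iff v w (h.p_ne h1)).1 h2 h1
  · rintro (hv | hv)
    · exact Y.irrefl hv.2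
    · exact h.not_adj _ _ (h.p_swap v) hv.2

/-- The graph with edges `u ~ v` whenever `σ u` and `v` are adjacent is again a double cover. -/
theorem of_adj_swap [Finite V] (h : TwoCover Y p σ c) {Z : SimpleGraph V}
    (hZ : ∀ u v, Z.Adj u v ↔ Y.Adj (σ u) v) : TwoCover Z p σ (n - 2 - c) where
  p_swap := h.p_swap
  swap_ne := h.swap_ne
  eq_or_eq := h.eq_or_eq
  not_adj u v e := by rw [hZ]; exact h.not_adj _ _ (by rw [h.p_swap, e])
  adj_swap_iff u v e := by
    rw [hZ, hZ]
    exact h.adj_swap_iff (σ u) v (by rwa [h.p_swap])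
  common u v e a := by
    rw [hZ, h.adj_swap_iff u v e, not_not] at a
    simp only [hZ]
    have := h.common_of_adj ((h.adj_swap_swap_iff u v).2 a)
    omega
  surj := h.surj

section Distances

variable (h : TwoCover Y p σ c) (hc : 0 < c)
include h hc

theorem exists_walk_two {u v : V} (e : p u ≠ p v) (a : ¬ Y.Adj u v) :
    ∃ w : Y.Walk u v, w.length = 2 := by
  have : {w | Y.Adj u w ∧ Y.Adj v w}.ncard ≠ 0 := by rw [h.common u v e a]; omega
  obtain ⟨w, h1, h2⟩ := Set.nonempty_of_ncard_ne_zero this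
  exact ⟨.cons h1 (.cons h2.symm .nil), rfl⟩

variable (hn : 2 ≤ n)
include hn

theorem exists_walk_three (u : V) : ∃ w : Y.Walk u (σ u), w.length = 3 := by
  have : Nontrivial (Fin n) := Fin.nontrivial_iff_two_le.2 hn
  obtain ⟨y, hy⟩ := exists_ne (p u)
  obtain ⟨v, rfl, hv⟩ := h.exists_adj u y hy.symm
  obtain ⟨w, hw⟩ := exists_walk_two h hc (u := v) (v := σ u) (by rwa [h.p_swap]) (by
    rw [Y.adj_comm, h.adj_swap_iff u v hy.symm]
    exact not_not.2 hv)
  exact ⟨.cons hv w, by simp [hw]⟩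

theorem connected : Y.Connected := by
  obtain ⟨u₀, -⟩ := h.surj ⟨0, by omega⟩
  have : Nonempty V := ⟨u₀⟩
  refine ⟨fun u v => ?_⟩
  by_cases e : p v = p u
  · rcases h.eq_or_eq u v e with rfl | rfl
    · exact SimpleGraph.Reachable.refl _
    · exact (exists_walk_three h hc hn u).choose.reachable
  · by_cases a : Y.Adj u v
    · exact a.reachable
    · exact (exists_walk_two h hc (Ne.symm e) a).choose.reachable

theorem dist_eq_two {u v : V} (e : p u ≠ p v) (a : ¬ Y.Adj u v) : Y.dist u v = 2 := by
  obtain ⟨w, hw⟩ := exists_walk_two h hc e a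
  have h1 := SimpleGraph.dist_le w
  have h2 := (connected h hc hn).one_lt_dist_of_ne_of_not_adj (fun r => e (congrArg p r)) a
  omega

theorem dist_swap (u : V) : Y.dist u (σ u) = 3 := by
  obtain ⟨w, hw⟩ := exists_walk_three h hc hn u
  have h1 := SimpleGraph.dist_le w
  have h2 := (connected h hc hn).one_lt_dist_of_ne_of_not_adj (h.swap_ne u).symm
    (h.not_adj _ _ (h.p_swap u).symm)
  have h3 : Y.dist u (σ u) ≠ 2 := by
    intro h3
    obtain ⟨w, a, b⟩ := (connected h hc hn).exists_adj_adj_of_dist_eq_two h3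
    exact (h.adj_swap_iff u w (h.p_ne a)).1 b.symm a
  omega

theorem dist_cases (u v : V) : (u = v ∧ Y.dist u v = 0) ∨ (Y.Adj u v ∧ Y.dist u v = 1) ∨
    ((p u ≠ p v ∧ ¬ Y.Adj u v) ∧ Y.dist u v = 2) ∨ (v = σ u ∧ Y.dist u v = 3) := by
  by_cases e : p v = p u
  · rcases h.eq_or_eq u v e with rfl | rfl
    · simp
    · exact Or.inr (Or.inr (Or.inr ⟨rfl, dist_swap h hc hn u⟩))
  · by_cases a : Y.Adj u v
    · exact Or.inr (Or.inl ⟨a, SimpleGraph.dist_eq_one_iff_adj.2 a⟩)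
    · exact Or.inr (Or.inr (Or.inl ⟨⟨Ne.symm e, a⟩, dist_eq_two h hc hn (Ne.symm e) a⟩))

theorem dist_eq_two_iff (u v : V) : Y.dist u v = 2 ↔ p u ≠ p v ∧ ¬ Y.Adj u v :=
  ⟨fun e => by rcases dist_cases h hc hn u v with r | r | r | r <;> first | exact r.1 | omega,
    fun e => dist_eq_two h hc hn e.1 e.2⟩

theorem dist_eq_three_iff (u v : V) : Y.dist u v = 3 ↔ v = σ u :=
  ⟨fun e => by rcases dist_cases h hc hn u v with r | r | r | r <;> first | exact r.1 | omega,
    fun e => e ▸ dist_swap h hc hn u⟩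

theorem diam_eq_three [Finite V] : Y.diam = 3 := by
  obtain ⟨u₀, -⟩ := h.surj ⟨0, by omega⟩
  have : Nonempty V := ⟨u₀⟩
  have hconn := connected h hc hn
  apply le_antisymm
  · obtain ⟨u, v, e⟩ := Y.exists_dist_eq_diam
    rw [← e]
    rcases dist_cases h hc hn u v with r | r | r | r <;> omega
  · rw [← dist_swap h hc hn u₀]
    exact SimpleGraph.dist_le_diam (SimpleGraph.connected_iff_ediam_ne_top.1 hconn)

theorem hasIntersectionArray [Finite V] :
    HasIntersectionArray Y ![n - 1, (2 - 1) * c, 1] ![1, c, n - 1] where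
  connected := connected h hc hn
  diam_eq := diam_eq_three h hc hn
  card_farther i u v e := by
    fin_cases i
    · obtain rfl : u = v := (connected h hc hn).dist_eq_zero_iff.1 (by simpa using e)
      simpa [neighborsAtDist] using h.ncard_neighbors u
    · have a : Y.Adj u v := SimpleGraph.dist_eq_one_iff_adj.1 (by simpa using e)
      -- Neighbours of `v` at distance two from `u` are the common neighbours of `v` and the
      -- nonadjacent vertex `σ u`.
      have := h.common (σ u) v (by rw [h.p_swap]; exact h.p_ne a)
        (by rw [h.adj_swap_iff u v (h.p_ne a)]; exact not_not.2 a)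
      simp only [neighborsAtDist, Fin.mk_one, Nat.reduceAdd, Matrix.cons_val_one,
        Matrix.cons_val_zero, Nat.add_one_sub_one, one_mul]
      refine Eq.trans ?_ this
      congr 1
      ext w
      simp only [Set.mem_ofPred_eq, dist_eq_two_iff h hc hn]
      constructor
      · rintro ⟨h1, h2, h3⟩
        exact ⟨(h.adj_swap_iff u w h2).2 h3, h1⟩
      · rintro ⟨h1, h2⟩
        have e := h.p_ne h1
        rw [h.p_swap] at e
        exact ⟨h2, e, (h.adj_swap_iff u w e).1 h1⟩
    · obtain ⟨e1, e2⟩ := (dist_eq_two_iff h hc hn u v).1 (by simpa using e)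
      simp only [neighborsAtDist, Fin.reduceFinMk, Nat.reduceAdd, Matrix.cons_val]
      rw [Set.ncard_eq_one]
      refine ⟨σ u, ?_⟩
      ext w
      simp only [Set.mem_ofPred_eq, dist_eq_three_iff h hc hn, Set.mem_singleton_iff,
        and_iff_right_iff_imp]
      rintro rfl
      exact ((h.adj_swap_iff u v e1).2 e2).symm
  card_closer i u v e := by
    fin_cases i
    · have a : Y.Adj u v := SimpleGraph.dist_eq_one_iff_adj.1 (by simpa using e)
      simp only [neighborsAtDist, Fin.zero_eta, Matrix.cons_val_zero]
      rw [Set.ncard_eq_one]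
      refine ⟨u, ?_⟩
      ext w
      simp only [Set.mem_ofPred_eq, (connected h hc hn).dist_eq_zero_iff, Set.mem_singleton_iff]
      constructor
      · exact fun r => r.2.symm
      · rintro rfl
        exact ⟨a.symm, rfl⟩
    · obtain ⟨e1, e2⟩ := (dist_eq_two_iff h hc hn u v).1 (by simpa using e)
      simp only [neighborsAtDist, Fin.mk_one, SimpleGraph.dist_eq_one_iff_adj,
        Matrix.cons_val_one, Matrix.cons_val_zero]
      refine Eq.trans ?_ (h.common u v e1 e2)
      congr 1
      ext w
      exact and_comm
    · obtain rfl := (dist_eq_three_iff h hc hn u v).1 (by simpa using e)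
      simp only [neighborsAtDist, Fin.reduceFinMk, Matrix.cons_val]
      refine Eq.trans ?_ (h.ncard_neighbors (σ u))
      congr 1
      ext w
      simp only [Set.mem_ofPred_eq, dist_eq_two_iff h hc hn, and_iff_left_iff_imp]
      intro a
      have e := h.p_ne a
      rw [h.p_swap] at e
      exact ⟨e, (h.adj_swap_iff u w e).1 a⟩

end Distances

/-- A distance-regular `(n, 2, c)` cover is a double cover in the combinatorial sense. -/
theorem of_isDistanceRegularCover [Finite V] (hY : IsDistanceRegularCover Y n 2 c) :
    ∃ (p : V → Fin n) (σ : V → V), TwoCover Y p σ c ∧ 0 < c ∧ 3 ≤ n := by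
  obtain ⟨⟨p, hp⟩, hA⟩ := hY
  have hconn := hA.connected
  have := hconn.nonempty
  have hex : ∀ u, ∃ u', u' ≠ u ∧ {v | p v = p u} = {u, u'} := by
    intro u
    obtain ⟨a, b, hab, e⟩ := Set.ncard_eq_two.1 (hp.ncard_cell (p u))
    have hu : u ∈ ({a, b} : Set V) := by rw [← e]; exact rfl
    rcases hu with rfl | rfl
    · exact ⟨b, hab.symm, e⟩
    · exact ⟨a, hab, by rw [e, Set.pair_comm]⟩
  choose σ hσ hcell using hex
  have hcell' : ∀ u v, p v = p u ↔ v = u ∨ v = σ u := fun u v => by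
    have := Set.ext_iff.1 (hcell u) v
    exact this
  have hpσ : ∀ u, p (σ u) = p u := fun u => (hcell' u _).2 (Or.inr rfl)
  have hdle : ∀ u v, Y.dist u v ≤ 3 := fun u v => by
    have := SimpleGraph.dist_le_diam (SimpleGraph.connected_iff_ediam_ne_top.1 hconn)
      (u := u) (v := v)
    rwa [hA.diam_eq] at this
  have hd3 : ∀ u, Y.dist u (σ u) = 3 := by
    intro u
    have h1 := hconn.one_lt_dist_of_ne_of_not_adj (hσ u).symm (hp.independent _ _ (hpσ u).symm)
    have h2 : Y.dist u (σ u) ≠ 2 := by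
      intro h3
      obtain ⟨w, a, b⟩ := hconn.exists_adj_adj_of_dist_eq_two h3
      have hne : p w ≠ p u := fun e => hp.independent _ _ e.symm a
      exact hσ u ((hp.matching w (p u) ((SimpleGraph.top_adj _ _).2 hne)).unique
        ⟨hpσ u, b⟩ ⟨rfl, a.symm⟩)
    have := hdle u (σ u)
    omega
  have hswap : ∀ u v, p u ≠ p v → (Y.Adj (σ u) v ↔ ¬ Y.Adj u v) := by
    intro u v e
    obtain ⟨w, ⟨hw, a⟩, huniq⟩ := hp.matching v (p u) ((SimpleGraph.top_adj _ _).2 e.symm)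
    have h1 : Y.Adj u v → u = w := fun b => huniq u ⟨rfl, b.symm⟩
    have h2 : Y.Adj (σ u) v → σ u = w := fun b => huniq _ ⟨hpσ u, b.symm⟩
    constructor
    · intro b b'
      exact hσ u ((h2 b).trans (h1 b').symm)
    · intro b
      rcases (hcell' u w).1 hw with rfl | rfl
      · exact absurd a.symm b
      · exact a.symm
  have hdist2 : ∀ u v, p u ≠ p v → ¬ Y.Adj u v → Y.dist u v = 2 := by
    intro u v e a
    have h1 := hconn.one_lt_dist_of_ne_of_not_adj (fun r => e (congrArg p r)) a
    have h2 := hdle u v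
    have h3 : Y.dist u v ≠ 3 := by
      -- At distance 3, all `n - 1` neighbours of `v` would be at distance 2 from `u`; but `σ u` is
      -- one of them, at distance 3.
      intro h3
      have key := hA.card_closer 2 u v h3
      have key0 := hA.card_farther 0 v v (by simp)
      simp only [neighborsAtDist, Fin.val_two, Matrix.cons_val, Fin.val_zero, zero_add,
        SimpleGraph.dist_eq_one_iff_adj, and_self, Matrix.cons_val_zero] at key key0
      have hsub : {w | Y.Adj v w ∧ Y.dist u w = 2} ⊆ {w | Y.Adj v w} := fun w hw => hw.1
      have heq := Set.eq_of_subset_of_ncard_le hsub (by rw [key, key0]) (Set.toFinite _)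
      have hmem : σ u ∈ {w | Y.Adj v w} := ((hswap u v e).2 a).symm
      rw [← heq] at hmem
      have := hmem.2
      rw [hd3] at this
      omega
    omega
  have H : TwoCover Y p σ c :=
    { p_swap := hpσ
      swap_ne := hσ
      eq_or_eq := fun u v e => (hcell' u v).1 e
      not_adj := hp.independent
      adj_swap_iff := hswap
      common := by
        intro u v e a
        have key := hA.card_closer 1 u v (by rw [hdist2 u v e a]; rfl)
        simp only [neighborsAtDist, Fin.val_one, SimpleGraph.dist_eq_one_iff_adj,
          Matrix.cons_val_one, Matrix.cons_val_zero] at key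
        rw [← key]
        congr 1
        ext w
        exact and_comm
      surj := fun y => by
        have : {v | p v = y}.ncard ≠ 0 := by rw [hp.ncard_cell y]; omega
        exact Set.nonempty_of_ncard_ne_zero this }
  obtain ⟨u⟩ := hconn.nonempty
  -- On a path `u, w, x, σ u`, the vertex `w` is a common neighbour of the nonadjacent `u` and `x`,
  -- so `c > 0`; the edge `u w` gives `c + 2 ≤ n`.
  obtain ⟨w, x, a, b, d⟩ := hconn.exists_adj_adj_adj_of_dist_eq_three (hd3 u)
  have h1 := H.common_of_adj a
  have e : p u ≠ p x := fun e => H.p_ne d (by rw [hpσ, e])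
  have hna : ¬ Y.Adj u x := by
    rw [← H.adj_swap_iff u x e]
    exact d.symm
  have h2 : {w | Y.Adj u w ∧ Y.Adj x w}.ncard ≠ 0 :=
    Set.ncard_ne_zero_of_mem (a := w) ⟨a, b.symm⟩ (Set.toFinite _)
  rw [H.common u x e hna] at h2
  exact ⟨p, σ, H, by omega, by omega⟩

/-- In a double cover with `c > 0`, vertices at distance two are the nonadjacent vertices in
different fibres. -/
theorem distanceTwoGraph_adj_iff (h : TwoCover Y p σ c) (hc : 0 < c) (hn : 2 ≤ n) (u v : V) :
    (distanceTwoGraph Y).Adj u v ↔ Y.Adj (σ u) v := by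
  refine (h.dist_eq_two_iff hc hn u v).trans ⟨fun e => (h.adj_swap_iff u v e.1).2 e.2, fun a => ?_⟩
  have e := h.p_ne a
  rw [h.p_swap] at e
  exact ⟨e, (h.adj_swap_iff u v e).1 a⟩

end TwoCover

/-! ### Spectral decomposition of the exponential. -/

section Exponential

open scoped Matrix.Norms.Operator

/-- If `M E = μ E` then `exp(s M) E = exp(s μ) E`. -/
theorem Matrix.exp_smul_mul_of_mul_eq_smul {V : Type*} [Fintype V] [DecidableEq V]
    {M E : Matrix V V ℂ} {μ : ℂ} (h : M * E = μ • E) (s : ℂ) :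
    NormedSpace.exp (s • M) * E = Complex.exp (s * μ) • E := by
  have hpow : ∀ k : ℕ, (s • M) ^ k * E = (s * μ) ^ k • E := by
    intro k
    induction k with
    | zero => simp
    | succ k ih =>
      rw [pow_succ, mul_assoc, smul_mul_assoc, h, smul_smul, mul_smul_comm, ih, smul_smul,
        pow_succ']
  have h1 := (NormedSpace.exp_series_hasSum_exp' (𝕂 := ℂ) (s • M)).mul_right E
  have h2 := (NormedSpace.exp_series_hasSum_exp' (𝕂 := ℂ) (s * μ)).smul_const E
  rw [← Complex.exp_eq_exp_ℂ] at h2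
  refine h1.unique (h2.congr_fun ?_)
  intro k
  rw [smul_mul_assoc, hpow, smul_eq_mul, mul_smul]

end Exponential

/-- The relations between the adjacency matrix `A` of a double cover with parameters `n`, `c` and
the permutation matrix `P` exchanging the vertices in each fibre. -/
structure CoverRelations {V : Type*} [Fintype V] [DecidableEq V] (A P : Matrix V V ℂ)
    (n c : ℂ) : Prop where
  sq_swap : P * P = 1
  comm : A * P = P * A
  sum_eq : ∀ u v, (1 + P + A + P * A) u v = 1
  sq_adj : A * A = (n - 1) • (1 : Matrix V V ℂ) + (n - 2 - c) • A + c • (P * A)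

namespace CoverRelations

variable {V : Type*} [Fintype V] [DecidableEq V] {A P : Matrix V V ℂ} {n c : ℂ}

theorem adj_swap_adj (h : CoverRelations A P n c) :
    A * (P * A) = (n - 1) • P + (n - 2 - c) • (P * A) + c • A := by
  rw [← mul_assoc, h.comm, mul_assoc, h.sq_adj]
  simp only [mul_add, mul_smul_comm, mul_one, ← mul_assoc, h.sq_swap, one_mul]

theorem swap_swap_adj (h : CoverRelations A P n c) : P * (P * A) = A := by
  rw [← mul_assoc, h.sq_swap, one_mul]

theorem mul_trivial (h : CoverRelations A P n c) :
    A * (1 + P + A + P * A) = (n - 1) • (1 + P + A + P * A) := by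
  simp only [mul_add, mul_one, h.comm, h.sq_adj, h.adj_swap_adj]
  module

/-- For a cover this is a multiple of the projection onto the `P`-fixed vectors orthogonal to the
constants. -/
theorem mul_symm (h : CoverRelations A P n c) :
    A * (n • (1 + P) - (1 + P + A + P * A)) =
      (-1 : ℂ) • (n • (1 + P) - (1 + P + A + P * A)) := by
  rw [mul_sub, h.mul_trivial]
  simp only [mul_add, mul_one, h.comm, mul_smul_comm]
  module

/-- The matrix is `(A - τ)(1 - P)`. On the image of `1 - P` one has `P A = -A`, so `sq_adj` becomes
`A² = (n - 1) + δ A`, that is `(A - θ)(A - τ) = 0`. -/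
theorem mul_skew (h : CoverRelations A P n c) {θ τ : ℂ} (hs : θ + τ = n - 2 - 2 * c)
    (hp : θ * τ = 1 - n) :
    A * (A - P * A - τ • (1 - P)) = θ • (A - P * A - τ • (1 - P)) := by
  obtain rfl : n = 1 - θ * τ := by linear_combination hp
  obtain rfl : c = (-1 - θ * τ - θ - τ) / 2 := by linear_combination hs / 2
  simp only [mul_sub, mul_one, mul_smul_comm, h.comm, h.sq_adj, h.adj_swap_adj]
  module

/-- The spectral decomposition of `exp(s A)`, written in terms of `1`, `P`, `A` and `P A`. -/
theorem exp_eq (h : CoverRelations A P n c) {θ τ : ℂ} (hs : θ + τ = n - 2 - 2 * c)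
    (hp : θ * τ = 1 - n) (hn : n ≠ 0) (hne : θ - τ ≠ 0) (s : ℂ) :
    NormedSpace.exp (s • A) =
      (1 / (2 * n)) • (Complex.exp (s * (n - 1)) • (1 + P + A + P * A)
        + Complex.exp (s * (-1)) • (n • (1 + P) - (1 + P + A + P * A)))
      + (1 / (2 * (θ - τ))) • (Complex.exp (s * θ) • (A - P * A - τ • (1 - P))
        - Complex.exp (s * τ) • (A - P * A - θ • (1 - P))) := by
  -- A resolution of the identity into eigenmatrices of `A`; multiplying it by `exp(s A)` gives the
  -- formula.
  have one_eq : (1 : Matrix V V ℂ) =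
      (1 / (2 * n)) • ((1 + P + A + P * A) + (n • (1 + P) - (1 + P + A + P * A)))
      + (1 / (2 * (θ - τ))) • ((A - P * A - τ • (1 - P)) - (A - P * A - θ • (1 - P))) := by
    have e1 : (1 + P + A + P * A) + (n • (1 + P) - (1 + P + A + P * A)) = n • (1 + P) := by
      module
    have e2 : (A - P * A - τ • (1 - P)) - (A - P * A - θ • (1 - P)) = (θ - τ) • (1 - P) := by
      module
    rw [e1, e2, smul_smul, smul_smul, show 1 / (2 * n) * n = 1 / 2 by field_simp,
      show 1 / (2 * (θ - τ)) * (θ - τ) = 1 / 2 by field_simp]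
    module
  rw [← Matrix.exp_smul_mul_of_mul_eq_smul h.mul_trivial,
    ← Matrix.exp_smul_mul_of_mul_eq_smul h.mul_symm,
    ← Matrix.exp_smul_mul_of_mul_eq_smul (h.mul_skew hs hp),
    ← Matrix.exp_smul_mul_of_mul_eq_smul
      (h.mul_skew (by rw [add_comm, hs]) (by rw [mul_comm, hp])),
    ← mul_add, ← mul_sub, ← mul_smul_comm, ← mul_smul_comm, ← mul_add, ← one_eq, mul_one]

/-- With `D = δ² + 4(n - 1)`, the matrix `N = 2(A - P A) - δ(1 - P)` satisfies `N³ = 4D N`. -/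
theorem cube_eq (h : CoverRelations A P n c) {N : Matrix V V ℂ} {δ : ℂ} (hδ : δ = n - 2 - 2 * c)
    (hN : N = (2 : ℂ) • (A - P * A) - δ • (1 - P)) :
    N * (N * N) = (4 * (δ ^ 2 + 4 * (n - 1))) • N := by
  have hPA : P * A * (P * A) = A * A := by
    rw [mul_assoc, h.adj_swap_adj, h.sq_adj]
    simp only [mul_add, mul_smul_comm, h.sq_swap, h.swap_swap_adj]
  have hPAP : P * A * P = A := by rw [mul_assoc, h.comm, h.swap_swap_adj]
  have hPAA : P * A * A = A * (P * A) := by rw [← mul_assoc, h.comm]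
  -- Here `N = (2A - δ)(1 - P)`, where `(2A - δ)² = D` on the image of `1 - P` and `(1 - P)² = 2(1 -
  -- P)`.
  have hsq : N * N = (2 * (δ ^ 2 + 4 * (n - 1))) • (1 - P) := by
    rw [hN, hδ]
    simp only [mul_sub, sub_mul, mul_one, one_mul, mul_smul_comm, smul_mul_assoc, h.comm, hPA, hPAP,
      hPAA, h.sq_adj, h.adj_swap_adj, h.swap_swap_adj, h.sq_swap]
    module
  have hNP : N * (1 - P) = (2 : ℂ) • N := by
    rw [hN]
    simp only [mul_sub, sub_mul, mul_one, one_mul, smul_mul_assoc, h.comm, hPAP, h.sq_swap]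
    module
  rw [hsq, mul_smul_comm, hNP, smul_smul]
  congr 1
  ring

end CoverRelations

/-! ### Arithmetic tools for integrality of the eigenvalues. -/

/-- If a Hermitian matrix satisfies `N³ = q N` with `q > 0`, then its trace is an integer multiple
of `√q`. -/
theorem Matrix.IsHermitian.exists_trace_eq_int_mul_sqrt {V : Type*} [Fintype V] [DecidableEq V]
    {N : Matrix V V ℂ} (hN : N.IsHermitian) {q : ℝ} (hq : 0 < q)
    (h : N * (N * N) = (q : ℂ) • N) : ∃ k : ℤ, N.trace = (k : ℂ) * (√q : ℝ) := by
  have key : ∀ j, ∃ k : ℤ, hN.eigenvalues j = k * √q := by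
    intro j
    set x := hN.eigenvalues j with hx
    have hv := hN.mulVec_eigenvectorBasis j
    rw [← hx] at hv
    set v : V → ℂ := ⇑(hN.eigenvectorBasis j) with hvdef
    have hv0 : v ≠ 0 := by
      intro e
      have h1 := hN.eigenvectorBasis.orthonormal.1 j
      have h2 : hN.eigenvectorBasis j = 0 := by
        ext i
        exact congrFun e i
      rw [h2, norm_zero] at h1
      exact zero_ne_one h1
    have h3 := congrArg (fun M => M.mulVec v) h
    simp only [← Matrix.mulVec_mulVec, Matrix.smul_mulVec, hv, Matrix.mulVec_smul] at h3
    obtain ⟨i, hi⟩ := Function.ne_iff.1 hv0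
    have h4 := congrFun h3 i
    simp only [Pi.smul_apply, smul_eq_mul, Complex.real_smul] at h4
    have h5 : ((x * (x * x) : ℝ) : ℂ) = ((q * x : ℝ) : ℂ) := by
      push_cast
      apply mul_right_cancel₀ (show v i ≠ 0 from hi)
      linear_combination h4
    have h6 : x * (x * x) = q * x := Complex.ofReal_injective h5
    have h7 : x * ((x - √q) * (x + √q)) = 0 := by
      have := Real.sq_sqrt hq.le
      linear_combination h6 - x * this
    rcases mul_eq_zero.1 h7 with e | e
    · exact ⟨0, by simp [e]⟩
    · rcases mul_eq_zero.1 e with e | e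
      · exact ⟨1, by push_cast; linarith⟩
      · exact ⟨-1, by push_cast; linarith⟩
  choose k hk using key
  refine ⟨∑ j, k j, ?_⟩
  rw [hN.trace_eq_sum_eigenvalues]
  simp only [hk]
  push_cast
  rw [Finset.sum_mul]
  exact Finset.sum_congr rfl fun j _ => by simp

/-- An integer that is the square of a nonzero rational number is the square of an integer. -/
theorem Int.exists_sq_of_sq_eq_sq_mul {m k D : ℤ} (hm : m ≠ 0) (h : m ^ 2 = k ^ 2 * D) :
    ∃ s, D = s ^ 2 := by
  have hk : k ≠ 0 := by
    rintro rfl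
    exact hm (by simpa using h)
  obtain ⟨s, rfl⟩ := (Int.pow_dvd_pow_iff two_ne_zero).1 ⟨D, h⟩
  refine ⟨s, ?_⟩
  have : k ^ 2 * (D - s ^ 2) = 0 := by linear_combination -h
  rcases mul_eq_zero.1 this with e | e
  · exact absurd (pow_eq_zero_iff two_ne_zero |>.1 e) hk
  · linarith

/-- The roots of `x² - δ x - N` are `(δ ± s)/2`, and `δ` and `s` have equal parity because their
squares agree mod 4. -/
theorem Int.exists_add_eq_mul_eq {δ N s : ℤ} (h : δ ^ 2 + 4 * N = s ^ 2) :
    ∃ θ τ : ℤ, θ + τ = δ ∧ θ * τ = -N := by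
  have hpar : Even (δ + s) := by
    have : Even ((δ + s) * (δ + s)) := ⟨δ ^ 2 + δ * s + 2 * N, by linear_combination -h⟩
    exact (Int.even_mul.1 this).elim id id
  obtain ⟨θ, hθ⟩ := hpar
  refine ⟨θ, δ - θ, by ring, ?_⟩
  obtain rfl : s = 2 * θ - δ := by linarith
  linarith [h, show (2 * θ - δ) ^ 2 = 4 * θ ^ 2 - 4 * θ * δ + δ ^ 2 by ring,
    show θ * (δ - θ) = θ * δ - θ ^ 2 by ring]

/-! ### Matrices of a double cover and integrality of `θ`, `τ`. -/

/-- The complex adjacency matrix of `Y`. -/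
noncomputable def complexAdjMatrix {V : Type*} (Y : SimpleGraph V) : Matrix V V ℂ :=
  open Classical in Y.adjMatrix ℂ

/-- The matrix with a one in the positions `(u, σ u)`. -/
def swapMatrix {V : Type*} [DecidableEq V] (σ : V → V) : Matrix V V ℂ :=
  Matrix.of fun u v => if σ u = v then 1 else 0

section Entries

variable {V : Type*} {Y : SimpleGraph V} {u v : V}

theorem complexAdjMatrix_of_adj (h : Y.Adj u v) : complexAdjMatrix Y u v = 1 := by
  simp [complexAdjMatrix, h]

theorem complexAdjMatrix_of_not_adj (h : ¬ Y.Adj u v) : complexAdjMatrix Y u v = 0 := by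
  simp [complexAdjMatrix, h]

theorem complexAdjMatrix_isHermitian : (complexAdjMatrix Y).IsHermitian := by
  ext u v
  rw [Matrix.conjTranspose_apply]
  by_cases a : Y.Adj u v
  · simp [complexAdjMatrix_of_adj a, complexAdjMatrix_of_adj a.symm]
  · simp [complexAdjMatrix_of_not_adj a, complexAdjMatrix_of_not_adj (fun b : Y.Adj v u => a b.symm)]

theorem complexAdjMatrix_mul_self [Fintype V] :
    (complexAdjMatrix Y * complexAdjMatrix Y) u v = ({w | Y.Adj u w ∧ Y.Adj v w}.ncard : ℂ) := by
  classical
  rw [Matrix.mul_apply, Set.ncard_eq_toFinset_card', Finset.card_eq_sum_ones, Nat.cast_sum,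
    ← Finset.sum_subset (Finset.subset_univ {w | Y.Adj u w ∧ Y.Adj v w}.toFinset)]
  · refine Finset.sum_congr rfl fun w hw => ?_
    simp only [Set.mem_toFinset, Set.mem_ofPred_eq] at hw
    rw [complexAdjMatrix_of_adj hw.1, complexAdjMatrix_of_adj hw.2.symm]
    simp
  · intro w _ hw
    simp only [Set.mem_toFinset, Set.mem_ofPred_eq, not_and_or] at hw
    rcases hw with hw | hw
    · rw [complexAdjMatrix_of_not_adj hw, zero_mul]
    · rw [complexAdjMatrix_of_not_adj (fun a => hw a.symm), mul_zero]

theorem swapMatrix_mul_apply [Fintype V] [DecidableEq V] (σ : V → V) (M : Matrix V V ℂ) :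
    (swapMatrix σ * M) u v = M (σ u) v := by
  simp [Matrix.mul_apply, swapMatrix]

end Entries

theorem intCast_sub_ne_zero_of_mul_neg {θ τ : ℤ} (h : θ * τ < 0) : (θ : ℂ) - τ ≠ 0 := by
  rw [sub_ne_zero, Ne, Int.cast_inj]
  rintro rfl
  exact absurd h (mul_self_nonneg θ).not_gt

namespace TwoCover

variable {V : Type*} {Y : SimpleGraph V} {n : ℕ} {p : V → Fin n} {σ : V → V} {c : ℕ}

theorem swap_eq_iff (h : TwoCover Y p σ c) {u v : V} : σ u = v ↔ u = σ v :=
  ⟨fun e => by rw [← e, h.swap_swap], fun e => by rw [e, h.swap_swap]⟩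

theorem complexAdjMatrix_swap (h : TwoCover Y p σ c) (u v : V) :
    complexAdjMatrix Y (σ u) v = complexAdjMatrix Y u (σ v) := by
  by_cases a : Y.Adj (σ u) v
  · rw [complexAdjMatrix_of_adj a, complexAdjMatrix_of_adj ((h.adj_swap_left_iff u v).1 a)]
  · rw [complexAdjMatrix_of_not_adj a,
      complexAdjMatrix_of_not_adj (fun b => a ((h.adj_swap_left_iff u v).2 b))]

theorem cases (h : TwoCover Y p σ c) (u v : V) :
    v = u ∨ v = σ u ∨ (Y.Adj u v ∧ ¬ Y.Adj (σ u) v ∧ u ≠ v ∧ σ u ≠ v) ∨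
      (¬ Y.Adj u v ∧ Y.Adj (σ u) v ∧ u ≠ v ∧ σ u ≠ v) := by
  by_cases e : p v = p u
  · have := h.eq_or_eq u v e
    tauto
  · have h1 := h.adj_swap_iff u v (Ne.symm e)
    have h2 : u ≠ v := fun r => e (by rw [r])
    have h3 : σ u ≠ v := fun r => e (by rw [← r, h.p_swap])
    tauto

variable [Fintype V] [DecidableEq V]

theorem mul_swapMatrix_apply (h : TwoCover Y p σ c) (M : Matrix V V ℂ) (u v : V) :
    (M * swapMatrix σ) u v = M u (σ v) := by
  simp [Matrix.mul_apply, swapMatrix, h.swap_eq_iff]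

theorem coverRelations (h : TwoCover Y p σ c) :
    CoverRelations (complexAdjMatrix Y) (swapMatrix σ) (n : ℂ) (c : ℂ) where
  sq_swap := by
    ext u v
    rw [swapMatrix_mul_apply, swapMatrix, Matrix.of_apply, h.swap_swap, Matrix.one_apply]
  comm := by
    ext u v
    rw [h.mul_swapMatrix_apply, swapMatrix_mul_apply, h.complexAdjMatrix_swap]
  sum_eq u v := by
    simp only [Matrix.add_apply, swapMatrix_mul_apply]
    rcases h.cases u v with rfl | rfl | ⟨a, b, d, e⟩ | ⟨a, b, d, e⟩
    · rw [complexAdjMatrix_of_not_adj (Y.irrefl), complexAdjMatrix_of_not_adj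
        (h.not_adj _ _ (h.p_swap _))]
      simp [swapMatrix, h.swap_ne]
    · rw [complexAdjMatrix_of_not_adj (h.not_adj _ _ (h.p_swap u).symm),
        complexAdjMatrix_of_not_adj (Y.irrefl)]
      simp [swapMatrix, (h.swap_ne u).symm]
    · rw [complexAdjMatrix_of_adj a, complexAdjMatrix_of_not_adj b]
      simp [swapMatrix, d, e]
    · rw [complexAdjMatrix_of_not_adj a, complexAdjMatrix_of_adj b]
      simp [swapMatrix, d, e]
  sq_adj := by
    ext u v
    rw [complexAdjMatrix_mul_self]
    simp only [Matrix.add_apply, Matrix.smul_apply, swapMatrix_mul_apply, smul_eq_mul]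
    rcases h.cases u v with rfl | rfl | ⟨a, b, d, e⟩ | ⟨a, b, d, e⟩
    · rw [complexAdjMatrix_of_not_adj (Y.irrefl), complexAdjMatrix_of_not_adj
        (h.not_adj _ _ (h.p_swap _))]
      simp only [and_self, h.ncard_neighbors]
      rw [Nat.cast_sub (p v).pos]
      simp
    · rw [complexAdjMatrix_of_not_adj (h.not_adj _ _ (h.p_swap u).symm),
        complexAdjMatrix_of_not_adj (Y.irrefl)]
      have : {w | Y.Adj u w ∧ Y.Adj (σ u) w} = ∅ := by
        ext w
        simp only [Set.mem_ofPred_eq, Set.mem_empty_iff_false, iff_false, not_and]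
        exact fun a b => (h.adj_swap_iff u w (h.p_ne a)).1 b a
      simp [this, (h.swap_ne u).symm]
    · rw [complexAdjMatrix_of_adj a, complexAdjMatrix_of_not_adj b, Matrix.one_apply_ne d]
      have := congrArg (Nat.cast (R := ℂ)) (h.common_of_adj a)
      push_cast at this
      linear_combination this
    · rw [complexAdjMatrix_of_not_adj a, complexAdjMatrix_of_adj b, Matrix.one_apply_ne d]
      rw [h.common u v (by have := h.p_ne b; rwa [h.p_swap] at this) a]
      simp

/-- In a double cover with `δ = n - 2c - 2 ≠ 0`, the eigenvalues other than `n - 1` and `-1`,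
which are the roots of `x² - δ x - (n - 1)`, are integers. -/
theorem exists_int_eigenvalues (h : TwoCover Y p σ c) (hn : 3 ≤ n) {δ : ℤ}
    (hδ : δ = (n : ℤ) - 2 * c - 2) (hδ0 : δ ≠ 0) :
    ∃ θ τ : ℤ, θ + τ = δ ∧ θ * τ = 1 - n := by
  obtain ⟨u₀, -⟩ := h.surj ⟨0, by omega⟩
  have hR := h.coverRelations
  set A := complexAdjMatrix Y with hA
  set P := swapMatrix σ with hP
  have hPH : P.IsHermitian := by
    ext u v
    by_cases e : σ v = u
    · simp [hP, swapMatrix, e, (h.swap_eq_iff.1 e).symm]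
    · have : σ u ≠ v := fun r => e (h.swap_eq_iff.1 r).symm
      simp [hP, swapMatrix, e, this]
  have hAH : A.IsHermitian := complexAdjMatrix_isHermitian
  have hδC : (δ : ℂ) = n - 2 - 2 * c := by
    rw [hδ]; push_cast; ring
  set N : Matrix V V ℂ := (2 : ℂ) • (A - P * A) - (δ : ℂ) • (1 - P) with hN
  have hNH : N.IsHermitian := by
    rw [Matrix.IsHermitian, hN, Matrix.conjTranspose_sub, Matrix.conjTranspose_smul,
      Matrix.conjTranspose_smul, Matrix.conjTranspose_sub, Matrix.conjTranspose_sub,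
      Matrix.conjTranspose_mul, hPH.eq, hAH.eq, Matrix.conjTranspose_one, hR.comm]
    simp
  set D : ℤ := δ ^ 2 + 4 * ((n : ℤ) - 1) with hD
  have hDpos : 0 < D := by
    have := sq_nonneg δ
    omega
  have hcube : N * (N * N) = (((4 * D : ℤ) : ℝ) : ℂ) • N := by
    rw [hR.cube_eq hδC hN, hD]
    congr 1
    push_cast
    ring
  have hq : (0 : ℝ) < ((4 * D : ℤ) : ℝ) := by exact_mod_cast (by omega : 0 < 4 * D)
  obtain ⟨k, hk⟩ := hNH.exists_trace_eq_int_mul_sqrt hq hcube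
  -- `A`, `P` and `P * A` have zero diagonal, so only `-δ • 1` contributes. As `δ ≠ 0`, the trace is
  -- a nonzero integer that is an integer multiple of `√(4D)`, which makes `D` a perfect square.
  have htr : N.trace = ((-(δ * Fintype.card V) : ℤ) : ℝ) := by
    have hA0 : A.trace = 0 := by
      refine Finset.sum_eq_zero fun u _ => ?_
      exact complexAdjMatrix_of_not_adj Y.irrefl
    have hP0 : P.trace = 0 := by
      refine Finset.sum_eq_zero fun u _ => ?_
      simp [hP, swapMatrix, h.swap_ne]
    have hPA0 : (P * A).trace = 0 := by
      refine Finset.sum_eq_zero fun u _ => ?_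
      rw [Matrix.diag_apply, hP, swapMatrix_mul_apply]
      exact complexAdjMatrix_of_not_adj (h.not_adj _ _ (h.p_swap u))
    rw [hN]
    simp only [Matrix.trace_sub, Matrix.trace_smul, hA0, hP0, hPA0, Matrix.trace_one]
    simp
  rw [htr] at hk
  have hreal : ((-(δ * Fintype.card V) : ℤ) : ℝ) = k * √((4 * D : ℤ) : ℝ) := by
    exact_mod_cast hk
  have hsq : (-(δ * Fintype.card V)) ^ 2 = (2 * k) ^ 2 * D := by
    have h1 : ((-(δ * Fintype.card V) : ℤ) : ℝ) ^ 2 = k ^ 2 * ((4 * D : ℤ) : ℝ) := by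
      rw [hreal, mul_pow, Real.sq_sqrt hq.le]
    have h2 : (-(δ * Fintype.card V)) ^ 2 = k ^ 2 * (4 * D) := by exact_mod_cast h1
    rw [h2]
    ring
  have hcard : (Fintype.card V : ℤ) ≠ 0 := by
    have : Nonempty V := ⟨u₀⟩
    exact_mod_cast Fintype.card_ne_zero
  obtain ⟨s, hs⟩ := Int.exists_sq_of_sq_eq_sq_mul (neg_ne_zero.2 (mul_ne_zero hδ0 hcard)) hsq
  obtain ⟨θ, τ, h1, h2⟩ := Int.exists_add_eq_mul_eq hs
  exact ⟨θ, τ, h1, by rw [h2]; ring⟩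

/-! ### Criterion for perfect state transfer. -/

section Transfer

variable (h : TwoCover Y p σ c) (hn : 3 ≤ n) {θ τ : ℤ} (hs : θ + τ = (n : ℤ) - 2 * c - 2)
  (hp : θ * τ = 1 - n)
include h hn hs hp

theorem transitionMatrix_eq (t : ℝ) :
    transitionMatrix Y t =
      (1 / (2 * (n : ℂ))) • (Complex.exp (Complex.I * t) ^ ((n : ℤ) - 1) •
          (1 + swapMatrix σ + complexAdjMatrix Y + swapMatrix σ * complexAdjMatrix Y)
        + Complex.exp (Complex.I * t) ^ (-1 : ℤ) • ((n : ℂ) • (1 + swapMatrix σ) -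
          (1 + swapMatrix σ + complexAdjMatrix Y + swapMatrix σ * complexAdjMatrix Y)))
      + (1 / (2 * ((θ : ℂ) - τ))) • (Complex.exp (Complex.I * t) ^ θ •
          (complexAdjMatrix Y - swapMatrix σ * complexAdjMatrix Y - (τ : ℂ) • (1 - swapMatrix σ))
        - Complex.exp (Complex.I * t) ^ τ •
          (complexAdjMatrix Y - swapMatrix σ * complexAdjMatrix Y
            - (θ : ℂ) • (1 - swapMatrix σ))) := by
  have hne := intCast_sub_ne_zero_of_mul_neg (show θ * τ < 0 by omega)
  have key := h.coverRelations.exp_eq (θ := θ) (τ := τ)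
    (by have := congrArg (Int.cast (R := ℂ)) hs; push_cast at this; linear_combination this)
    (by have := congrArg (Int.cast (R := ℂ)) hp; push_cast at this; linear_combination this)
    (by exact_mod_cast (by omega : n ≠ 0)) hne (Complex.I * t)
  have hexp : ∀ m : ℤ, Complex.exp (Complex.I * t) ^ m = Complex.exp (Complex.I * t * m) := by
    intro m
    rw [← Complex.exp_int_mul, mul_comm]
  rw [hexp, hexp, hexp, hexp]
  push_cast
  exact key

/-- The hypotheses make `U(t)` act as `z⁻¹` on `P`-fixed vectors and as `-z⁻¹` on `P`-negated ones,
so `U(t) = z⁻¹ P`. -/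
theorem perfectStateTransferAt_of (t : ℝ) (h1 : Complex.exp (Complex.I * t) ^ (n : ℤ) = 1)
    (h2 : Complex.exp (Complex.I * t) ^ (θ + 1) = -1)
    (h3 : Complex.exp (Complex.I * t) ^ (τ + 1) = -1) : PerfectStateTransferAt Y t := by
  obtain ⟨u, -⟩ := h.surj ⟨0, by omega⟩
  have hU := h.transitionMatrix_eq hn hs hp t
  have hz : Complex.exp (Complex.I * t) ≠ 0 := Complex.exp_ne_zero _
  set z := Complex.exp (Complex.I * t) with hzdef
  rw [zpow_add₀ hz, zpow_one] at h2 h3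
  have hne := intCast_sub_ne_zero_of_mul_neg (show θ * τ < 0 by omega)
  have hn0 : (n : ℂ) ≠ 0 := by exact_mod_cast (by omega : n ≠ 0)
  have g0 : z ^ ((n : ℤ) - 1) = z⁻¹ := by rw [zpow_sub₀ hz, h1, zpow_one, one_div]
  have g1 : z ^ (-1 : ℤ) = z⁻¹ := zpow_neg_one z
  have g2 : z ^ θ = -z⁻¹ := by rw [eq_neg_iff_add_eq_zero]; field_simp; linear_combination h2
  have g3 : z ^ τ = -z⁻¹ := by rw [eq_neg_iff_add_eq_zero]; field_simp; linear_combination h3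
  refine ⟨u, σ u, (h.swap_ne u).symm, z⁻¹, ?_⟩
  have hUP : transitionMatrix Y t = z⁻¹ • swapMatrix σ := by
    rw [hU, g0, g1, g2, g3]
    match_scalars <;> field_simp <;> ring
  rw [hUP, Matrix.smul_mulVec, Matrix.mulVec_single_one]
  congr 1
  ext w
  simp [swapMatrix, Pi.single_apply, h.swap_eq_iff]

/-- Column `u` of `U(t)` vanishes off `v`. As degrees are at least 2, zeros occur at `u`, at a
neighbour `w` of `u`, and at a neighbour `x` of `σ u`. The entries at `w` and `x` give `z^(n-1) =
z⁻¹` and `z^θ = z^τ`; the diagonal entry then gives `z^θ = -z⁻¹`. -/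
theorem zpow_eq_of_perfectStateTransferAt {t : ℝ} (hT : PerfectStateTransferAt Y t) :
    Complex.exp (Complex.I * t) ^ (θ + 1) = -1 ∧ Complex.exp (Complex.I * t) ^ (τ + 1) = -1 := by
  obtain ⟨u, v, huv, γ, hγ⟩ := hT
  have hU := h.transitionMatrix_eq hn hs hp t
  have hz : Complex.exp (Complex.I * t) ≠ 0 := Complex.exp_ne_zero _
  set z := Complex.exp (Complex.I * t) with hzdef
  have hne := intCast_sub_ne_zero_of_mul_neg (show θ * τ < 0 by omega)
  have hn0 : (n : ℂ) ≠ 0 := by exact_mod_cast (by omega : n ≠ 0)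
  have hcol : ∀ w, w ≠ v → transitionMatrix Y t w u = 0 := by
    intro w hw
    have := congrFun hγ w
    rw [Matrix.mulVec_single_one] at this
    simpa [hw] using this
  have hnbr : ∀ x, ∃ w, w ≠ v ∧ Y.Adj x w := by
    intro x
    obtain ⟨w, hw, hwv⟩ := Set.exists_ne_of_one_lt_ncard
      (s := {w | Y.Adj x w}) (by rw [h.ncard_neighbors]; omega) v
    exact ⟨w, hwv, hw⟩
  have e0 := hcol u huv
  have hadj : ∃ w, w ≠ v ∧ Y.Adj w u := (hnbr u).imp fun w hw => ⟨hw.1, hw.2.symm⟩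
  have hadj' : ∃ w, w ≠ v ∧ Y.Adj (σ w) u := (hnbr (σ u)).imp fun w hw =>
    ⟨hw.1, (h.adj_swap_left_iff w u).2 hw.2.symm⟩
  obtain ⟨w, hwv, hw⟩ := hadj
  obtain ⟨x, hxv, hx⟩ := hadj'
  have e1 := hcol w hwv
  have e2 := hcol x hxv
  have hsu : ∀ w, Y.Adj w u → w ≠ u ∧ σ w ≠ u ∧ ¬ Y.Adj (σ w) u := fun w a =>
    ⟨a.ne, fun e => h.p_ne a (by rw [← e, h.p_swap]),
      fun b => (h.adj_swap_iff w u (h.p_ne a)).1 b a⟩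
  obtain ⟨hw1, hw2, hw3⟩ := hsu w hw
  obtain ⟨hx1, hx2, hx3⟩ := hsu (σ x) hx
  rw [h.swap_swap] at hx2 hx3
  rw [hU] at e0 e1 e2
  simp only [Matrix.add_apply, Matrix.sub_apply, Matrix.smul_apply, smul_eq_mul,
    swapMatrix_mul_apply] at e0 e1 e2
  rw [complexAdjMatrix_of_not_adj Y.irrefl,
    complexAdjMatrix_of_not_adj (h.not_adj _ _ (h.p_swap u))] at e0
  rw [complexAdjMatrix_of_adj hw, complexAdjMatrix_of_not_adj hw3] at e1
  rw [complexAdjMatrix_of_adj hx, complexAdjMatrix_of_not_adj hx3] at e2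
  simp only [swapMatrix, Matrix.of_apply, h.swap_ne, hw1, hw2, hx1, hx2, if_false,
    Matrix.one_apply_eq, Matrix.one_apply_ne, ne_eq, not_false_eq_true] at e0 e1 e2
  generalize hg0 : z ^ ((n : ℤ) - 1) = g0 at e0 e1 e2
  generalize hg1 : z ^ (-1 : ℤ) = g1 at e0 e1 e2
  generalize hg2 : z ^ θ = g2 at e0 e1 e2
  generalize hg3 : z ^ τ = g3 at e0 e1 e2
  have f1 : g0 = g1 := by
    have : 1 / (2 * (n : ℂ)) * (g0 - g1) = 0 := by linear_combination (e1 + e2) / 2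
    exact sub_eq_zero.1 ((mul_eq_zero.1 this).resolve_left (by simpa using hn0))
  have f2 : g2 = g3 := by
    have : 1 / (2 * ((θ : ℂ) - τ)) * (g2 - g3) = 0 := by linear_combination (e1 - e2) / 2
    exact sub_eq_zero.1 ((mul_eq_zero.1 this).resolve_left (by simpa using hne))
  have f3 : g2 = -g1 := by
    rw [f1, ← f2] at e0
    field_simp at e0
    have : (n : ℂ) * (θ - τ) * (g2 + g1) = 0 := by linear_combination e0
    have := (mul_eq_zero.1 this).resolve_left (mul_ne_zero hn0 hne)
    linear_combination this
  rw [zpow_neg_one] at hg1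
  rw [zpow_add₀ hz, zpow_add₀ hz, zpow_one, hg2, hg3, ← f2, f3, ← hg1]
  constructor <;> field_simp

end Transfer

end TwoCover

/-! ### Parity obstructions and conclusion. -/

/-- Otherwise `z^(xy)` would equal both `(-1)^y` and `(-1)^x`. -/
theorem zpow_ne_neg_one_of_odd_add {z : ℂ} {x y : ℤ} (h : Odd (x + y)) :
    ¬ (z ^ x = -1 ∧ z ^ y = -1) := by
  rintro ⟨hx, hy⟩
  have key : (-1 : ℂ) ^ y = (-1) ^ x := by
    rw [← hx, ← zpow_mul, mul_comm, zpow_mul, hy, hx]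
  rcases Int.even_or_odd x with e | e
  · have o : Odd y := by
      have := h.sub_even e
      rwa [add_sub_cancel_left] at this
    rw [o.neg_one_zpow, e.neg_one_zpow] at key
    norm_num at key
  · have o : Even y := by
      have := h.sub_odd e
      rwa [add_sub_cancel_left] at this
    rw [o.neg_one_zpow, e.neg_one_zpow] at key
    norm_num at key

/-- When `x + y ≡ 2` mod 4, the even product makes both exponents even, and their halves have odd
sum; the odd case then applies to `z²`. -/
theorem zpow_ne_neg_one_of_add_mod_four {z : ℂ} {x y c : ℤ} (hxy : x * y = -2 * c)
    (h : Odd (x + y) ∨ (4 : ℤ) ∣ x + y - 2) : ¬ (z ^ x = -1 ∧ z ^ y = -1) := by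
  rcases h with h | ⟨k, hk⟩
  · exact zpow_ne_neg_one_of_odd_add h
  · have hev : Even (x * y) := ⟨-c, by rw [hxy]; ring⟩
    have hadd : Even (x + y) := ⟨2 * k + 1, by omega⟩
    obtain ⟨⟨a, rfl⟩, ⟨b, rfl⟩⟩ : Even x ∧ Even y := by
      rw [Int.even_mul] at hev
      rw [Int.even_add] at hadd
      tauto
    have := zpow_ne_neg_one_of_odd_add (z := z ^ (2 : ℤ)) (x := a) (y := b) ⟨k, by omega⟩
    rwa [← zpow_mul, ← zpow_mul, two_mul, two_mul] at this

theorem Complex.exp_I_mul_pi_half :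
    Complex.exp (Complex.I * ((Real.pi / 2 : ℝ) : ℂ)) = Complex.I := by
  rw [mul_comm]
  push_cast
  exact Complex.exp_pi_div_two_mul_I

theorem Complex.I_zpow_of_four_dvd {m : ℤ} (h : (4 : ℤ) ∣ m) : Complex.I ^ m = 1 := by
  obtain ⟨k, rfl⟩ := h
  rw [zpow_mul, show (4 : ℤ) = ((4 : ℕ) : ℤ) from rfl, zpow_natCast, Complex.I_pow_four, one_zpow]

theorem Complex.I_zpow_of_four_dvd_sub_two {m : ℤ} (h : (4 : ℤ) ∣ m - 2) : Complex.I ^ m = -1 := by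
  have : m = (m - 2) + 2 := by ring
  rw [this, zpow_add₀ Complex.I_ne_zero, Complex.I_zpow_of_four_dvd h, one_mul,
    show (2 : ℤ) = ((2 : ℕ) : ℤ) from rfl, zpow_natCast, Complex.I_sq]

theorem mainTheorem6 {V : Type*} [Fintype V] [DecidableEq V] (X : SimpleGraph V) (n c : ℕ)
    (hX : IsDistanceRegularCover X n 2 c)
    (δ : ℤ) (hδ : δ = (n : ℤ) - 2 * (c : ℤ) - 2)
    (hδ0 : δ ≠ 0) (hδ2 : δ ≠ 2) (hδm2 : δ ≠ -2) :
    (c + 2 ≠ n → IsDistanceRegularCover (distanceTwoGraph X) n 2 (n - 2 - c)) ∧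
    (δ ≡ 2 [ZMOD 4] → ∃ a : ℕ, Odd a ∧
      (PerfectStateTransferAt X (Real.pi / (2 * (a : ℝ))) ∨
        PerfectStateTransferAt (distanceTwoGraph X) (Real.pi / (2 * (a : ℝ))))) ∧
    (Odd δ ∨ (4 : ℤ) ∣ δ →
      ¬ AdmitsPerfectStateTransfer X ∧ ¬ AdmitsPerfectStateTransfer (distanceTwoGraph X)) := by
  obtain ⟨p, σ, h, hc, hn⟩ := TwoCover.of_isDistanceRegularCover hX
  have hZadj := h.distanceTwoGraph_adj_iff hc (by omega)
  have hZ := h.of_adj_swap hZadj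
  obtain ⟨θ, τ, hs, hp⟩ := h.exists_int_eigenvalues hn hδ hδ0
  obtain ⟨u, hu⟩ := h.surj ⟨0, by omega⟩
  obtain ⟨w, -, hw⟩ := h.exists_adj u ⟨1, by omega⟩ (by simp [hu])
  have hcn : c + 2 ≤ n := by
    have := h.common_of_adj hw
    omega
  have hs' : θ + τ = (n : ℤ) - 2 * c - 2 := by rw [hs, hδ]
  have hsZ : -θ + -τ = (n : ℤ) - 2 * ((n - 2 - c : ℕ) : ℤ) - 2 := by omega
  have hpZ : -θ * -τ = 1 - (n : ℤ) := by rw [neg_mul_neg, hp]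
  have hxy : (θ + 1) * (τ + 1) = -2 * (c : ℤ) := by linear_combination hp + hs'
  have hxyZ : (-θ + 1) * (-τ + 1) = -2 * ((n : ℤ) - 2 - c) := by linear_combination hp - hs'
  refine ⟨fun hne => ?_, fun hmod => ⟨1, odd_one, ?_⟩, fun hpar => ⟨?_, ?_⟩⟩
  · exact ⟨⟨p, hZ.isFoldCovering⟩, hZ.hasIntersectionArray (by omega) (by omega)⟩
  · rw [Nat.cast_one, mul_one]
    have hadd : (4 : ℤ) ∣ δ - 2 := hmod.symm.dvd
    have hev : Even ((θ + 1) * (τ + 1)) := ⟨-c, by rw [hxy]; ring⟩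
    have hevadd : Even ((θ + 1) + (τ + 1)) := by
      obtain ⟨k, hk⟩ := hadd
      exact ⟨2 * k + 2, by omega⟩
    obtain ⟨⟨a, ha⟩, ⟨b, hb⟩⟩ : Even (θ + 1) ∧ Even (τ + 1) := by
      rw [Int.even_mul] at hev
      rw [Int.even_add] at hevadd
      tauto
    have hn4 : (4 : ℤ) ∣ (n : ℤ) := by
      obtain ⟨k, hk⟩ := hadd
      have e : (n : ℤ) = 4 * (k + 1 - a * b) := by
        obtain rfl : θ = a + a - 1 := by omega
        obtain rfl : τ = b + b - 1 := by omega
        linear_combination hp + hk + hs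
      exact ⟨_, e⟩
    -- Since `2(a + b) = δ + 2` is divisible by 4, `a` and `b` have the same parity. If odd, `i^(2a)
    -- = i^(2b) = -1` serves `X`; if even, the exponents `2 - 2a`, `2 - 2b` of `X_2` are `2` mod 4.
    rcases Int.even_or_odd a with e | e
    · right
      obtain ⟨a', rfl⟩ := e
      apply hZ.perfectStateTransferAt_of hn hsZ hpZ <;> rw [Complex.exp_I_mul_pi_half]
      · exact Complex.I_zpow_of_four_dvd hn4
      · exact Complex.I_zpow_of_four_dvd_sub_two (by omega)
      · exact Complex.I_zpow_of_four_dvd_sub_two (by omega)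
    · left
      obtain ⟨a', rfl⟩ := e
      apply h.perfectStateTransferAt_of hn hs' hp <;> rw [Complex.exp_I_mul_pi_half]
      · exact Complex.I_zpow_of_four_dvd hn4
      · exact Complex.I_zpow_of_four_dvd_sub_two (by omega)
      · exact Complex.I_zpow_of_four_dvd_sub_two (by omega)
  · rintro ⟨t, ht⟩
    refine zpow_ne_neg_one_of_add_mod_four hxy ?_
      (h.zpow_eq_of_perfectStateTransferAt hn hs' hp ht)
    refine hpar.imp (fun ⟨k, hk⟩ => ⟨k + 1, by omega⟩) (fun hk => by omega)
  · rintro ⟨t, ht⟩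
    refine zpow_ne_neg_one_of_add_mod_four hxyZ ?_
      (hZ.zpow_eq_of_perfectStateTransferAt hn hsZ hpZ ht)
    refine hpar.imp (fun ⟨k, hk⟩ => ⟨-k, by omega⟩) (fun hk => by omega)
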